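/- Let $E/\mathbb{Q}$ be an elliptic curve and let $\ell$ be a prime. Let $E[\ell]\subset E(\overline{\mathbb{Q}})$ be the subgroup of $\ell$-torsion points, let $\mathbb{Q}(E[\ell])\subset\overline{\mathbb{Q}}$ be the field generated by the coordinates of the points of $E[\ell]$, and let $$\overline{\rho}_{E,\ell}:\mathrm{Gal}(\mathbb{Q}(E[\ell])/\mathbb{Q})\to\mathrm{Aut}_{\mathbb{F}_\ell}(E[\ell])\cong\mathrm{GL}_2(\mathbb{F}_\ell)$$ be the homomorphism given by the action of the Galois group on $E[\ell]$. Let $p\neq\ell$ be a prime of good reduction for $E$, let $\mathfrak{P}$ be a prime of $\mathbb{Q}(E[\ell])$ above $p$, and let $\sigma_{\mathfrak{P}}\in\mathrm{Gal}(\mathbb{Q}(E[\ell])/\mathbb{Q})$ be the corresponding Frobenius element, i.e. $\sigma_{\mathfrak{P}}(x)\equiv x^p\pmod{\mathfrak{P}}$ for every algebraic integer $x\in\mathbb{Q}(E[\ell])$. Let $\#E(\mathbb{F}_p)$ be the number of $\mathbb{F}_p$-points, including the point at infinity, of the reduction modulo $p$ of a Weierstrass equation of $E$ that is minimal at $p$.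 Then $\ell$ divides $\#E(\mathbb{F}_p)$ if and only if $1$ is an eigenvalue of $\overline{\rho}_{E,\ell}(\sigma_{\mathfrak{P}})$. -/

import Mathlib

open scoped NumberField

noncomputable section

namespace WeierstrassCurve

/-! ### Reduction of a rational curve at a prime -/

/-- The ring `ℤ_(p) = {x ∈ ℚ | x is p-integral}`, a discrete valuation ring with fraction field `ℚ`
and residue field `𝔽_p`. -/
abbrev ratLocal (p : ℕ) [Fact p.Prime] : ValuationSubring ℚ :=
  (Rat.padicValuation p).valuationSubring

instance ratLocal_isDiscreteValuationRing (p : ℕ) [Fact p.Prime] :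
    IsDiscreteValuationRing (ratLocal p) := by
  have hp : Nat.Prime p := Fact.out
  have : (Rat.padicValuation p).IsNontrivial := by
    refine ⟨(p : ℚ), ?_, ?_⟩
    · simp
    · rw [Rat.padicValuation_self]
      decide
  infer_instance

/-- `E/ℚ` has good reduction at `p`: a Weierstrass equation of `E` that is minimal at `p` has
discriminant prime to `p`. -/
def HasGoodReductionAt (E : WeierstrassCurve ℚ) (p : ℕ) [Fact p.Prime] : Prop :=
  (E.minimal (ratLocal p)).HasGoodReduction (ratLocal p)

/-- The reduction of `E/ℚ` modulo `p` (of a Weierstrass equation of `E` that is minimal at `p`),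
a curve over the residue field `𝔽_p` of `ℤ_(p)`. -/
def reductionAt (E : WeierstrassCurve ℚ) (p : ℕ) [Fact p.Prime] :
    WeierstrassCurve (IsLocalRing.ResidueField (ratLocal p)) :=
  (E.minimal (ratLocal p)).reduction (ratLocal p)

/-- The number `#E(𝔽_p)` of points of the reduction of `E` modulo `p`, the point at infinity
included. -/
def numPointsMod (E : WeierstrassCurve ℚ) (p : ℕ) [Fact p.Prime] : ℕ :=
  Nat.card (E.reductionAt p).toAffine.Point

/-! ### Torsion points and the Galois representation on them -/

/-- An algebraic closure of `ℚ`. -/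
abbrev QBar : Type := AlgebraicClosure ℚ

instance instDecidableEqQBar : DecidableEq QBar := Classical.decEq _

section Torsion

variable (E : WeierstrassCurve ℚ) (n : ℕ)

/-- The `n`-torsion subgroup `E(L)[n]` of the group of `L`-rational points of `E`. -/
abbrev torsionPoints (L : Type) [Field L] [DecidableEq L] [Algebra ℚ L] :
    AddSubgroup (E.baseChange L).toAffine.Point :=
  AddSubgroup.torsionBy (E.baseChange L).toAffine.Point (n : ℤ)

instance torsionPointsModule (L : Type) [Field L] [DecidableEq L] [Algebra ℚ L] :
    Module (ZMod n) (E.torsionPoints n L) :=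
  AddSubgroup.torsionBy.zmodModule

/-- The map `E(L)[n] → E(M)[n]` that applies a homomorphism `L → M` to the coordinates. -/
def torsionMap {L M : Type} [Field L] [DecidableEq L] [Algebra ℚ L]
    [Field M] [DecidableEq M] [Algebra ℚ M] (f : L →ₐ[ℚ] M) :
    E.torsionPoints n L →ₗ[ZMod n] E.torsionPoints n M :=
  AddMonoidHom.toZModLinearMap n <|
    ((Affine.Point.map (W' := E) f).comp (E.torsionPoints n L).subtype).codRestrict
      (E.torsionPoints n M) fun P => by
        rw [AddSubgroup.torsionBy.nsmul_iff, AddMonoidHom.comp_apply, ← map_nsmul, ← map_nsmul,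
          AddSubgroup.torsionBy.nsmul P, map_zero, map_zero]

theorem coe_torsionMap {L M : Type} [Field L] [DecidableEq L] [Algebra ℚ L]
    [Field M] [DecidableEq M] [Algebra ℚ M] (f : L →ₐ[ℚ] M) (P : E.torsionPoints n L) :
    (E.torsionMap n f P : (E.baseChange M).toAffine.Point) =
      Affine.Point.map (W' := E) f P.1 := rfl

theorem torsionMap_torsionMap {L M N : Type} [Field L] [DecidableEq L] [Algebra ℚ L]
    [Field M] [DecidableEq M] [Algebra ℚ M] [Field N] [DecidableEq N] [Algebra ℚ N]
    (f : L →ₐ[ℚ] M) (g : M →ₐ[ℚ] N) (P : E.torsionPoints n L) :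
    E.torsionMap n g (E.torsionMap n f P) = E.torsionMap n (g.comp f) P :=
  Subtype.ext (Affine.Point.map_map f g P.1)

theorem torsionMap_injective {L M : Type} [Field L] [DecidableEq L] [Algebra ℚ L]
    [Field M] [DecidableEq M] [Algebra ℚ M] (f : L →ₐ[ℚ] M) :
    Function.Injective (E.torsionMap n f) := fun _ _ h =>
  Subtype.ext (Affine.Point.map_injective f (congrArg Subtype.val h))

theorem exists_torsionMap_eq {L M : Type} [Field L] [DecidableEq L] [Algebra ℚ L]
    [Field M] [DecidableEq M] [Algebra ℚ M] (f : L →ₐ[ℚ] M) {x y : L}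
    (h : (E.baseChange M).toAffine.Nonsingular (f x) (f y))
    (hP : Affine.Point.some _ _ h ∈ E.torsionPoints n M) :
    ∃ Q, E.torsionMap n f Q = ⟨Affine.Point.some _ _ h, hP⟩ := by
  have h' : (E.baseChange L).toAffine.Nonsingular x y :=
    (Affine.baseChange_nonsingular (W := E) (f := f) f.injective ..).mp h
  refine ⟨⟨Affine.Point.some _ _ h', ?_⟩, Subtype.ext rfl⟩
  rw [AddSubgroup.torsionBy.nsmul_iff] at hP ⊢
  apply Affine.Point.map_injective (W' := E) f
  rw [map_nsmul, map_zero]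
  exact hP

/-- The action of `Gal(L/ℚ)` on `E(L)[n]` by `ℤ/nℤ`-linear maps. -/
def torsionAction (L : Type) [Field L] [DecidableEq L] [Algebra ℚ L] :
    Gal(L/ℚ) →* Module.End (ZMod n) (E.torsionPoints n L) where
  toFun σ := E.torsionMap n (σ : L →ₐ[ℚ] L)
  map_one' := by
    ext P
    exact congrArg _ (by rcases P with ⟨_ | _, _⟩ <;> rfl)
  map_mul' σ τ := by
    ext P
    exact congrArg _ (by rcases P with ⟨_ | _, _⟩ <;> rfl)

/-- The field `ℚ(E[n])`, the subfield of `ℚ̄` generated by the coordinates of the `n`-torsion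
points of `E`. -/
def torsionField : IntermediateField ℚ QBar :=
  IntermediateField.adjoin ℚ
    {z | ∃ (x y : QBar) (h : (E.baseChange QBar).toAffine.Nonsingular x y),
      Affine.Point.some x y h ∈ E.torsionPoints n QBar ∧ (z = x ∨ z = y)}

/-- All `n`-torsion points over `ℚ̄` are rational over `ℚ(E[n])`. -/
theorem torsionMap_torsionField_bijective :
    Function.Bijective (E.torsionMap n (E.torsionField n).val) := by
  refine ⟨E.torsionMap_injective n _, ?_⟩
  rintro ⟨_ | ⟨x, y, h⟩, hP⟩
  · exact ⟨0, map_zero _⟩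
  · have hx : x ∈ E.torsionField n :=
      IntermediateField.subset_adjoin _ _ ⟨x, y, h, hP, Or.inl rfl⟩
    have hy : y ∈ E.torsionField n :=
      IntermediateField.subset_adjoin _ _ ⟨x, y, h, hP, Or.inr rfl⟩
    exact E.exists_torsionMap_eq n (E.torsionField n).val (x := ⟨x, hx⟩) (y := ⟨y, hy⟩) h hP

/-- The identification of `E(ℚ(E[n]))[n]` with `E[n] = E(ℚ̄)[n]`. -/
def torsionFieldEquiv :
    E.torsionPoints n (E.torsionField n) ≃ₗ[ZMod n] E.torsionPoints n QBar :=
  LinearEquiv.ofBijective _ (E.torsionMap_torsionField_bijective n)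

/-- The representation `ρ̄_{E,n} : Gal(ℚ(E[n])/ℚ) → GL(E[n])` on the `ℤ/nℤ`-module `E[n] = E(ℚ̄)[n]`,
where `GL(E[n])` is the group of `ℤ/nℤ`-linear automorphisms of `E[n]`, that is `GL₂(ℤ/nℤ)` once a
basis of `E[n]` is chosen. -/
def torsionRep :
    Gal(E.torsionField n/ℚ) →* LinearMap.GeneralLinearGroup (ZMod n) (E.torsionPoints n QBar) :=
  (((E.torsionFieldEquiv n).conjRingEquiv : _ →* _).comp
    (E.torsionAction n (E.torsionField n))).toHomUnits

/-- `ρ̄_{E,n}(σ)` acts on `E[n]` as every automorphism of `ℚ̄` that extends `σ`. -/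
theorem torsionRep_apply_of_extends (σ : Gal(E.torsionField n/ℚ)) (τ : Gal(QBar/ℚ))
    (h : ∀ x : E.torsionField n, τ x = σ x) (P : E.torsionPoints n QBar) :
    (E.torsionRep n σ).1 P = E.torsionAction n QBar τ P := by
  obtain ⟨Q, rfl⟩ := (E.torsionFieldEquiv n).surjective P
  change E.torsionFieldEquiv n (E.torsionAction n _ σ
    ((E.torsionFieldEquiv n).symm (E.torsionFieldEquiv n Q))) = _
  rw [LinearEquiv.symm_apply_apply]
  refine (E.torsionMap_torsionMap n _ _ Q).trans
    (Eq.trans ?_ (E.torsionMap_torsionMap n _ _ Q).symm)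
  congr 2
  ext x
  exact (h x).symm

end Torsion

end WeierstrassCurve

end

/-!
Both conditions say that a certain nonzero `ℓ`-torsion point exists. By Cauchy's theorem `ℓ` divides
`#E(𝔽_p)` if and only if the reduced curve has a nonzero `ℓ`-torsion point over `𝔽_p`, and `1` is an
eigenvalue of Frobenius if and only if Frobenius fixes a nonzero point of `E[ℓ]`. The two are matched
by reduction modulo `𝔓`, which is a bijection between the `ℓ`-torsion points of the two curves and
turns the action of Frobenius into raising coordinates to the `p`-th power.

The properties of reduction are derived from one fact about a Weierstrass curve over any ring
(`exists_xCoord_nsmul_polynomials`): there are polynomials `U`, `V` over that ring such that `n • P`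
has `x`-coordinate `(U(x) : V(x))` for every nonsingular affine point `P = (x, y)` over every field,
and `V` has leading coefficient `n²`. So if `n` is a unit, the `x`-coordinates of the nonzero
`n`-torsion points are the roots of a monic polynomial, which is compatible with reduction. Let `A` be
an integrally closed domain with fraction field `L`, and `A → k` a homomorphism to a field.

* Nonzero torsion points over `L` have coordinates in `A`
  (`exists_algebraMap_eq_of_nsmul_eq_zero`), and their reductions are torsion
  (`nsmul_reduction_eq_zero`).
* Torsion points lift if `L` contains all of them, because the monic polynomial then splits over `A`
  (`exists_lift_of_nsmul_eq_zero`).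
* Reduction is injective on torsion (`eq_of_reduction_eq`): if `P ≠ Q` have the same reduction, then
  `P - Q` is torsion, hence integral, so the line through `P` and `-Q` has integral slope; and this
  forces the common reduction to be a singular point.

These are applied to the local ring `A` of `ℚ(E[ℓ])` at `𝔓` and to the minimal model of `E` at `p`.
The isomorphism of `E` with this model is a change of variables over `ℚ`, so it respects torsion and
the Galois action.
-/

section

open Polynomial

universe u

/-! ### Duplication and differential addition on `x`-coordinates -/

namespace WeierstrassCurve.Affine.Point

variable {F : Type*} [Field F] [DecidableEq F] {W : WeierstrassCurve F}

/-- `IsXCoord P u w`: the pair `(u : w)` is a representative of the image of `P` under the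
`x`-coordinate map to `ℙ¹`, the point at infinity mapping to `(1 : 0)`. In particular
`(u, w) ≠ (0, 0)`. -/
def IsXCoord (P : W.toAffine.Point) (u w : F) : Prop :=
  ∃ c : F, c ≠ 0 ∧ u = c * P.xRep 0 ∧ w = c * P.xRep 1

omit [DecidableEq F] in
lemma isXCoord_some {x y : F} (h : W.toAffine.Nonsingular x y) : IsXCoord (some x y h) x 1 :=
  ⟨1, one_ne_zero, by simp, by simp⟩

omit [DecidableEq F] in
lemma IsXCoord.eq_zero_iff {P : W.toAffine.Point} {u w : F} (h : IsXCoord P u w) :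
    w = 0 ↔ P = 0 := by
  obtain ⟨c, hc, -, rfl⟩ := h
  rcases P with _ | ⟨x, y, h⟩
  · simp [← zero_def]
  · simp [hc]

/-- The formula for `x(P + Q) + x(P - Q)` in terms of `x(P)` and `x(Q)`, the denominator being
`(x(P) - x(Q))²`. -/
lemma addX_add_addX_negY {x₁ x₂ y₁ y₂ : F} (h₁ : W.toAffine.Equation x₁ y₁)
    (h₂ : W.toAffine.Equation x₂ y₂) (hx : x₁ ≠ x₂) :
    (W.toAffine.addX x₁ x₂ (W.toAffine.slope x₁ x₂ y₁ y₂) +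
      W.toAffine.addX x₁ x₂ (W.toAffine.slope x₁ x₂ y₁ (W.toAffine.negY x₂ y₂))) * (x₁ - x₂) ^ 2 =
    2 * (x₁ + x₂) * (x₁ * x₂) + W.b₂ * (x₁ * x₂) + W.b₄ * (x₁ + x₂) + W.b₆ := by
  have hd := sub_ne_zero.2 hx
  rw [equation_iff] at h₁ h₂
  rw [slope_of_X_ne hx, slope_of_X_ne hx]
  simp only [addX, negY, b₂, b₄, b₆]
  field_simp
  linear_combination 2 * h₁ + 2 * h₂

omit [DecidableEq F] in
lemma sq_two_mul_Y {x y : F} (h : W.toAffine.Equation x y) :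
    (2 * y + W.a₁ * x + W.a₃) ^ 2 = 4 * x ^ 3 + W.b₂ * x ^ 2 + 2 * W.b₄ * x + W.b₆ := by
  rw [equation_iff] at h
  simp only [b₂, b₄, b₆]
  linear_combination 4 * h

omit [DecidableEq F] in
/-- The numerator of the duplication formula, in terms of the numerator and the denominator of the
slope of the tangent line. -/
lemma sq_add_tangent {x y : F} (h : W.toAffine.Equation x y) :
    (3 * x ^ 2 + 2 * W.a₂ * x + W.a₄ - W.a₁ * y) ^ 2 + W.a₁ *
      (3 * x ^ 2 + 2 * W.a₂ * x + W.a₄ - W.a₁ * y) * (2 * y + W.a₁ * x + W.a₃) -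
      (W.a₂ + 2 * x) * (2 * y + W.a₁ * x + W.a₃) ^ 2 =
    x ^ 4 - W.b₄ * x ^ 2 - 2 * W.b₆ * x - W.b₈ := by
  rw [equation_iff] at h
  simp only [b₄, b₆, b₈]
  linear_combination -(W.a₁ ^ 2 + 4 * W.a₂ + 8 * x) * h

/-- The duplication formula in homogeneous form. It has no exceptional points: where the
denominator vanishes, the numerator is the square of the partial derivative in `X`, which is nonzero
because the point is nonsingular. -/
lemma IsXCoord.two_nsmul {P : W.toAffine.Point} {u w : F} (h : IsXCoord P u w) :
    IsXCoord (2 • P) (u ^ 4 - W.b₄ * u ^ 2 * w ^ 2 - 2 * W.b₆ * u * w ^ 3 - W.b₈ * w ^ 4)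
      (4 * u ^ 3 * w + W.b₂ * u ^ 2 * w ^ 2 + 2 * W.b₄ * u * w ^ 3 + W.b₆ * w ^ 4) := by
  obtain ⟨c, hc, rfl, rfl⟩ := h
  rcases P with _ | ⟨x, y, h⟩
  · refine ⟨c ^ 4, pow_ne_zero _ hc, ?_, ?_⟩ <;> simp [← zero_def]
  · have hs := sq_two_mul_Y h.1
    have hd := sq_add_tangent h.1
    rw [_root_.two_nsmul]
    by_cases hy : y = W.toAffine.negY x y
    · have h0 : 2 * y + W.a₁ * x + W.a₃ = 0 := by
        rw [negY] at hy; linear_combination hy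
      have hn := ((nonsingular_iff _ _).1 h).2
      have hX : 3 * x ^ 2 + 2 * W.a₂ * x + W.a₄ - W.a₁ * y ≠ 0 := by
        rcases hn with hn | hn
        · exact fun e => hn (by linear_combination -e)
        · exact absurd (by rwa [negY] at hy) hn
      rw [add_self_of_Y_eq hy]
      refine ⟨c ^ 4 * (3 * x ^ 2 + 2 * W.a₂ * x + W.a₄ - W.a₁ * y) ^ 2,
        mul_ne_zero (pow_ne_zero _ hc) (pow_ne_zero _ hX), ?_, ?_⟩
      · rw [h0] at hd
        simp
        linear_combination -c ^ 4 * hd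
      · rw [h0] at hs
        simp
        linear_combination -c ^ 4 * hs
    · have h0 : 2 * y + W.a₁ * x + W.a₃ ≠ 0 := by
        intro h0; apply hy; rw [negY]; linear_combination h0
      rw [add_self_of_Y_ne hy]
      refine ⟨c ^ 4 * (2 * y + W.a₁ * x + W.a₃) ^ 2,
        mul_ne_zero (pow_ne_zero _ hc) (pow_ne_zero _ h0), ?_, ?_⟩
      · have e : y - W.toAffine.negY x y = 2 * y + W.a₁ * x + W.a₃ := by rw [negY]; ring
        have hm := slope_of_Y_ne rfl hy
        rw [e, eq_div_iff h0] at hm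
        rw [← hm] at hd
        simp
        linear_combination -c ^ 4 * hd
      · simp
        linear_combination -c ^ 4 * hs

/-- Differential addition: when `B - A` is a given affine point, the homogeneous `x`-coordinate of
`A + B` is a polynomial in those of `A` and `B`. It has no exceptional points, as `A ≠ B`. -/
lemma IsXCoord.add {A B : W.toAffine.Point} {u w u' w' x y : F} (hA : IsXCoord A u w)
    (hB : IsXCoord B u' w') (h : W.toAffine.Nonsingular x y) (hAB : B = A + some x y h) :
    IsXCoord (A + B)
      (2 * (u * w' + u' * w) * (u * u') + W.b₂ * (u * u') * (w * w')
        + W.b₄ * (u * w' + u' * w) * (w * w') + W.b₆ * (w * w') ^ 2 - x * (u * w' - u' * w) ^ 2)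
      ((u * w' - u' * w) ^ 2) := by
  obtain ⟨c, hc, rfl, rfl⟩ := hA
  obtain ⟨d, hd, rfl, rfl⟩ := hB
  have hcd : (c * d) ^ 2 ≠ 0 := pow_ne_zero _ (mul_ne_zero hc hd)
  rcases A with _ | ⟨x₁, y₁, h₁⟩
  · rw [← zero_def, zero_add] at *
    subst hAB
    refine ⟨(c * d) ^ 2, hcd, ?_, ?_⟩ <;> simp <;> ring
  rcases B with _ | ⟨x₂, y₂, h₂⟩
  · rw [← zero_def, add_zero] at *
    have : some x₁ y₁ h₁ = - some x y h := by rw [eq_neg_iff_add_eq_zero, ← hAB]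
    rw [neg_some] at this
    have hx : x₁ = x := by simpa using congrArg (fun P => xRep P 0) this
    refine ⟨(c * d) ^ 2, hcd, ?_, ?_⟩ <;> (simp [hx]; ring)
  by_cases hx : x₁ = x₂
  · subst hx
    rcases X_eq_iff (h₁ := h₁) (h₂ := h₂).1 rfl with hh | hh
    · rw [hh] at hAB
      simp at hAB
    · -- here `A = -B`; were `2 * y₂ + a₁ * x₁ + a₃ = 0`, then also `A = B`
      rw [hh, neg_add_cancel]
      have h0 : 2 * y₂ + W.a₁ * x₁ + W.a₃ ≠ 0 := by
        intro h0
        have : y₁ = W.toAffine.negY x₁ y₂ := by simpa using hh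
        have e : y₁ = y₂ := by rw [this, negY]; linear_combination -h0
        subst e
        simp at hAB
      refine ⟨(c * d) ^ 2 * (2 * y₂ + W.a₁ * x₁ + W.a₃) ^ 2, mul_ne_zero hcd (pow_ne_zero _ h0), ?_, ?_⟩
      · have := sq_two_mul_Y h₂.1
        simp
        linear_combination -(c * d) ^ 2 * this
      · simp; ring
  · have hs := addX_add_addX_negY h₁.1 h₂.1 hx
    have hdif : some x₁ y₁ h₁ + - some x₂ y₂ h₂ = - some x y h := by rw [hAB]; abel
    rw [neg_some, add_of_X_ne hx, neg_some] at hdif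
    have hx3 := congrArg (fun P => xRep P 0) hdif
    simp only [xRep_some, Matrix.cons_val_zero] at hx3
    rw [add_of_X_ne hx]
    have hd' := sub_ne_zero.2 hx
    refine ⟨(c * d) ^ 2 * (x₁ - x₂) ^ 2, mul_ne_zero hcd (pow_ne_zero _ hd'), ?_, ?_⟩
    · rw [hx3] at hs
      simp only [xRep_some, Matrix.cons_val_zero, Matrix.cons_val_one]
      linear_combination -(c * d) ^ 2 * hs
    · simp; ring

end WeierstrassCurve.Affine.Point

/-! ### The polynomials of multiplication by `n` -/

/-- `p` has degree at most `n`, and `a` is its (possibly zero) coefficient of degree `n`. -/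
def Polynomial.HasTopCoeff {R : Type*} [CommRing R] (p : R[X]) (n : ℕ) (a : R) : Prop :=
  p.natDegree ≤ n ∧ p.coeff n = a

namespace Polynomial.HasTopCoeff

variable {R : Type*} [CommRing R] {p q : R[X]} {m n : ℕ} {a b : R}

lemma const (a : R) : (C a).HasTopCoeff 0 a := ⟨by simp, by simp⟩

lemma add (hp : p.HasTopCoeff n a) (hq : q.HasTopCoeff n b) : (p + q).HasTopCoeff n (a + b) :=
  ⟨(natDegree_add_le _ _).trans (max_le hp.1 hq.1), by rw [coeff_add, hp.2, hq.2]⟩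

lemma sub (hp : p.HasTopCoeff n a) (hq : q.HasTopCoeff n b) : (p - q).HasTopCoeff n (a - b) :=
  ⟨(natDegree_sub_le _ _).trans (max_le hp.1 hq.1), by rw [coeff_sub, hp.2, hq.2]⟩

lemma mul (hp : p.HasTopCoeff m a) (hq : q.HasTopCoeff n b) :
    (p * q).HasTopCoeff (m + n) (a * b) :=
  ⟨natDegree_mul_le_of_le hp.1 hq.1, by rw [coeff_mul_add_eq_of_natDegree_le hp.1 hq.1, hp.2, hq.2]⟩

lemma pow (hp : p.HasTopCoeff m a) (k : ℕ) : (p ^ k).HasTopCoeff (k * m) (a ^ k) :=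
  ⟨natDegree_pow_le_of_le k hp.1, by rw [coeff_pow_of_natDegree_le hp.1, hp.2]⟩

lemma raise (hp : p.HasTopCoeff m a) (h : m < n) : p.HasTopCoeff n 0 :=
  ⟨hp.1.trans h.le, coeff_eq_zero_of_natDegree_lt (hp.1.trans_lt h)⟩

lemma cast (hp : p.HasTopCoeff m a) (h : m = n) (h' : a = b) : p.HasTopCoeff n b :=
  h ▸ h' ▸ hp

end Polynomial.HasTopCoeff

namespace WeierstrassCurve

open WeierstrassCurve.Affine

/-- Multiplication by `n` on `x`-coordinates is given by two universal polynomials, `U` of degree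
`n²` with leading coefficient `1` and `V` of degree `n² - 1` with coefficient `n²`. They are those
of the Montgomery ladder: `2m` is reached by duplication, and `2m + 1` by differential addition of
`m` and `m + 1`. As neither formula has exceptional points, `(U : V)` is correct at every nonsingular
affine point over every field. -/
theorem exists_xCoord_nsmul_polynomials {R : Type*} [CommRing R] (W : WeierstrassCurve R) (n : ℕ)
    (hn : n ≠ 0) : ∃ U V : R[X],
      U.HasTopCoeff (n ^ 2) 1 ∧ V.HasTopCoeff (n ^ 2 - 1) ((n : R) ^ 2) ∧
      ∀ (F : Type u) [Field F] [DecidableEq F] (f : R →+* F) (x y : F)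
        (h : (W.map f).toAffine.Nonsingular x y),
        Point.IsXCoord (n • Point.some x y h) (U.eval₂ f x) (V.eval₂ f x) := by
  induction n using Nat.strong_induction_on with
  | _ n ih =>
  have two : (C 2 : R[X]) = 2 := rfl
  have four : (C 4 : R[X]) = 4 := rfl
  rcases Nat.even_or_odd' n with ⟨m, rfl | rfl⟩
  · obtain ⟨U, V, hU, hV, H⟩ := ih m (by lia) (by lia)
    obtain ⟨d, hd⟩ : ∃ d, m ^ 2 = d + 1 := Nat.exists_eq_succ_of_ne_zero (pow_ne_zero _ (by lia))
    have hd' : (2 * m) ^ 2 = 4 * d + 4 := by rw [mul_pow, hd]; ring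
    rw [hd] at hU hV
    rw [hd']
    rw [Nat.add_sub_cancel] at hV
    refine ⟨U ^ 4 - C W.b₄ * U ^ 2 * V ^ 2 - C 2 * C W.b₆ * U * V ^ 3 - C W.b₈ * V ^ 4,
      C 4 * U ^ 3 * V + C W.b₂ * U ^ 2 * V ^ 2 + C 2 * C W.b₄ * U * V ^ 3 + C W.b₆ * V ^ 4,
      ?_, ?_, ?_⟩
    · refine (HasTopCoeff.sub (.sub (.sub ((hU.pow 4).cast (by ring) rfl)
        ((((HasTopCoeff.const _).mul (hU.pow 2)).mul (hV.pow 2)).raise (by lia)))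
        (((((HasTopCoeff.const _).mul (.const _)).mul hU).mul (hV.pow 3)).raise (by lia)))
        (((HasTopCoeff.const _).mul (hV.pow 4)).raise (by lia))).cast rfl (by simp)
    · refine (HasTopCoeff.add (.add (.add
        ((((HasTopCoeff.const _).mul (hU.pow 3)).mul hV).cast (by lia) rfl)
        ((((HasTopCoeff.const _).mul (hU.pow 2)).mul (hV.pow 2)).raise (by lia)))
        (((((HasTopCoeff.const _).mul (.const _)).mul hU).mul (hV.pow 3)).raise (by lia)))
        (((HasTopCoeff.const _).mul (hV.pow 4)).raise (by lia))).cast rfl (by simp; ring)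
    · intro F _ _ f x y h
      convert! (H F f x y h).two_nsmul using 1
      · rw [← mul_nsmul, mul_comm]
      · simp [eval₂_sub, eval₂_mul, eval₂_pow, two]
      · simp [eval₂_pow, two, four]
  rcases Nat.eq_zero_or_pos m with rfl | hm
  · refine ⟨X, 1, ⟨by simpa using natDegree_X_le, by simp⟩, ⟨by simp, by simp⟩,
      fun F _ _ f x y h => ?_⟩
    simpa using Point.isXCoord_some h
  · obtain ⟨U, V, hU, hV, H⟩ := ih m (by lia) (by lia)
    obtain ⟨U', V', hU', hV', H'⟩ := ih (m + 1) (by lia) (by lia)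
    obtain ⟨d, hd⟩ : ∃ d, m ^ 2 = d + 1 := Nat.exists_eq_succ_of_ne_zero (pow_ne_zero _ (by lia))
    have he : (m + 1) ^ 2 = (d + 2 * m + 1) + 1 := by linear_combination hd
    have hd' : (2 * m + 1) ^ 2 = 4 * d + 4 * m + 5 := by linear_combination 4 * hd
    rw [hd] at hU hV
    rw [he] at hU' hV'
    rw [hd']
    rw [Nat.add_sub_cancel] at hV hV'
    have hd1 : (U * V' + U' * V).HasTopCoeff (2 * d + 2 * m + 2) ((m + 1) ^ 2 + m ^ 2) :=
      (((hU.mul hV').cast (by lia) rfl).add ((hU'.mul hV).cast (by lia) rfl)).cast rfl (by simp)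
    have hd2 : (U * V' - U' * V).HasTopCoeff (2 * d + 2 * m + 2) (2 * m + 1) :=
      (((hU.mul hV').cast (by lia) rfl).sub ((hU'.mul hV).cast (by lia) rfl)).cast rfl
        (by push_cast; ring)
    have hX : (X : R[X]).HasTopCoeff 1 1 := ⟨natDegree_X_le, by simp⟩
    refine ⟨C 2 * (U * V' + U' * V) * (U * U') + C W.b₂ * (U * U') * (V * V')
        + C W.b₄ * (U * V' + U' * V) * (V * V') + C W.b₆ * (V * V') ^ 2 - X * (U * V' - U' * V) ^ 2,
      (U * V' - U' * V) ^ 2, ?_, ?_, ?_⟩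
    · refine (HasTopCoeff.sub (.add (.add (.add
        ((((HasTopCoeff.const _).mul hd1).mul (hU.mul hU')).cast (by lia) rfl)
        ((((HasTopCoeff.const _).mul (hU.mul hU')).mul (hV.mul hV')).raise (by lia)))
        ((((HasTopCoeff.const _).mul hd1).mul (hV.mul hV')).raise (by lia)))
        (((HasTopCoeff.const _).mul ((hV.mul hV').pow 2)).raise (by lia)))
        ((hX.mul (hd2.pow 2)).cast (by lia) rfl)).cast rfl (by ring)
    · exact (hd2.pow 2).cast (by lia) (by push_cast; ring)
    · intro F _ _ f x y h
      convert! (H F f x y h).add (H' F f x y h) h ?_ using 1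
      · rw [← add_nsmul]; congr 1; ring
      · simp [eval₂_sub, eval₂_mul, eval₂_pow, two]
      · simp [eval₂_sub, eval₂_mul, eval₂_pow]
      · rw [succ_nsmul]

end WeierstrassCurve

/-! ### Changes of variables and the group law -/

namespace WeierstrassCurve

open WeierstrassCurve.Affine

section VariableChange

variable {F : Type*} [Field F] (C : VariableChange F) (W : WeierstrassCurve F)

lemma equation_variableChange_iff (x y : F) : (C • W).toAffine.Equation x y ↔
    W.toAffine.Equation (C.u ^ 2 * x + C.r) (C.u ^ 3 * y + C.u ^ 2 * C.s * x + C.t) := by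
  have hu := C.u.ne_zero
  rw [equation_iff', equation_iff']
  simp only [variableChange_def, Units.val_inv_eq_inv_val]
  rw [← mul_right_inj' (pow_ne_zero 6 hu), mul_zero]
  refine Eq.congr ?_ rfl
  field_simp
  ring

lemma nonsingular_variableChange_iff (x y : F) : (C • W).toAffine.Nonsingular x y ↔
    W.toAffine.Nonsingular (C.u ^ 2 * x + C.r) (C.u ^ 3 * y + C.u ^ 2 * C.s * x + C.t) := by
  have hu := C.u.ne_zero
  rw [nonsingular_iff', nonsingular_iff', equation_variableChange_iff]
  refine and_congr_right fun _ => ?_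
  simp only [variableChange_def, Units.val_inv_eq_inv_val]
  set X := W.a₁ * (C.u ^ 3 * y + C.u ^ 2 * C.s * x + C.t) - (3 * (C.u ^ 2 * x + C.r : F) ^ 2 +
    2 * W.a₂ * (C.u ^ 2 * x + C.r) + W.a₄) with hX
  set Y := 2 * (C.u ^ 3 * y + C.u ^ 2 * C.s * x + C.t) + W.a₁ * (C.u ^ 2 * x + C.r : F) + W.a₃
    with hY
  set X' := _ * y - _ with hX'
  set Y' := 2 * y + _ + _ with hY'
  have e1 : C.u ^ 4 * X' = X + C.s * Y := by
    rw [hX', hX, hY]; field_simp; ring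
  have e2 : C.u ^ 3 * Y' = Y := by
    rw [hY', hY]; field_simp; ring
  have h1 : X' = 0 ↔ X + C.s * Y = 0 := by rw [← e1]; simp [hu]
  have h2 : Y' = 0 ↔ Y = 0 := by rw [← e2]; simp [hu]
  rw [← not_and_or, ← not_and_or, h1, h2]
  refine not_congr ⟨?_, ?_⟩
  · rintro ⟨h, h'⟩
    exact ⟨by simpa [h'] using h, h'⟩
  · rintro ⟨h, h'⟩
    exact ⟨by simp [h, h'], h'⟩

variable [DecidableEq F]

lemma slope_variableChange {x₁ x₂ y₁ y₂ : F} (h : ¬(x₁ = x₂ ∧ y₁ = (C • W).toAffine.negY x₂ y₂))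
    (h₁ : (C • W).toAffine.Equation x₁ y₁) (h₂ : (C • W).toAffine.Equation x₂ y₂) :
    W.toAffine.slope (C.u ^ 2 * x₁ + C.r) (C.u ^ 2 * x₂ + C.r)
      (C.u ^ 3 * y₁ + C.u ^ 2 * C.s * x₁ + C.t) (C.u ^ 3 * y₂ + C.u ^ 2 * C.s * x₂ + C.t) =
    C.u * (C • W).toAffine.slope x₁ x₂ y₁ y₂ + C.s := by
  have hu := C.u.ne_zero
  by_cases hx : x₁ = x₂
  · subst hx
    have hy : y₁ ≠ (C • W).toAffine.negY x₁ y₂ := fun e => h ⟨rfl, e⟩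
    obtain rfl := Y_eq_of_Y_ne h₁ h₂ rfl hy
    have hd : 2 * y₁ + (C • W).a₁ * x₁ + (C • W).a₃ ≠ 0 := by
      intro e
      apply hy
      rw [negY]
      linear_combination e
    have e2 : 2 * (C.u ^ 3 * y₁ + C.u ^ 2 * C.s * x₁ + C.t) + W.a₁ * (C.u ^ 2 * x₁ + C.r : F) +
        W.a₃ = C.u ^ 3 * (2 * y₁ + (C • W).a₁ * x₁ + (C • W).a₃) := by
      simp only [variableChange_def, Units.val_inv_eq_inv_val]
      field_simp; ring
    have e3 : 3 * (C.u ^ 2 * x₁ + C.r : F) ^ 2 + 2 * W.a₂ * (C.u ^ 2 * x₁ + C.r) + W.a₄ -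
        W.a₁ * (C.u ^ 3 * y₁ + C.u ^ 2 * C.s * x₁ + C.t) = C.u ^ 4 *
        (3 * x₁ ^ 2 + 2 * (C • W).a₂ * x₁ + (C • W).a₄ - (C • W).a₁ * y₁) + C.s * (
        C.u ^ 3 * (2 * y₁ + (C • W).a₁ * x₁ + (C • W).a₃)) := by
      simp only [variableChange_def, Units.val_inv_eq_inv_val]
      field_simp; ring
    rw [slope_of_Y_ne rfl hy, slope_of_Y_ne rfl, e3]
    · have q : ∀ (V : WeierstrassCurve F) (x y : F),
          y - V.toAffine.negY x y = 2 * y + V.a₁ * x + V.a₃ := by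
        intro V x y; rw [negY]; ring
      rw [q, q, e2]
      generalize 2 * y₁ + (C • W).a₁ * x₁ + (C • W).a₃ = D at hd
      generalize 3 * x₁ ^ 2 + 2 * (C • W).a₂ * x₁ + (C • W).a₄ - (C • W).a₁ * y₁ = N
      field_simp
    · intro e
      rw [negY] at e
      have : C.u ^ 3 * (2 * y₁ + (C • W).a₁ * x₁ + (C • W).a₃) = 0 := by
        rw [← e2]; linear_combination e
      simp [hu, hd] at this
  · have hd := sub_ne_zero.2 hx
    rw [slope_of_X_ne hx, slope_of_X_ne]
    · have : (C.u ^ 2 * x₁ + C.r : F) - (C.u ^ 2 * x₂ + C.r) = C.u ^ 2 * (x₁ - x₂) := by ring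
      rw [this]
      field_simp
      ring
    · simpa [hu] using hx

/-- The homomorphism `(x, y) ↦ (u²x + r, u³y + u²sx + t)` from the points of `C • W` to those
of `W`, for the admissible change of variables `C = (u, r, s, t)`. -/
def variableChangeHom : (C • W).toAffine.Point →+ W.toAffine.Point where
  toFun P := match P with
    | 0 => 0
    | .some x y h => .some _ _ ((nonsingular_variableChange_iff C W x y).1 h)
  map_zero' := rfl
  map_add' := by
    have hu := C.u.ne_zero
    rintro (_ | ⟨x₁, y₁, h₁⟩) (_ | ⟨x₂, y₂, h₂⟩)
    any_goals simp only [← Point.zero_def, zero_add, add_zero]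
    have key : (C.u ^ 3 * y₁ + C.u ^ 2 * C.s * x₁ + C.t : F) = W.toAffine.negY (C.u ^ 2 * x₂ + C.r)
        (C.u ^ 3 * y₂ + C.u ^ 2 * C.s * x₂ + C.t) - C.u ^ 2 * C.s * (x₂ - x₁) ↔
        y₁ = (C • W).toAffine.negY x₂ y₂ := by
      rw [← mul_right_inj' (pow_ne_zero 3 hu)]
      simp only [negY, variableChange_def, Units.val_inv_eq_inv_val]
      field_simp
      constructor <;> intro h <;> linear_combination h
    by_cases hxy : x₁ = x₂ ∧ y₁ = (C • W).toAffine.negY x₂ y₂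
    · have h2 := key.2 hxy.2
      obtain ⟨rfl, h⟩ := hxy
      rw [sub_self, mul_zero, sub_zero] at h2
      rw [Point.add_of_Y_eq rfl h, Point.add_of_Y_eq rfl h2]
    · have hxy' : ¬ ((C.u ^ 2 * x₁ + C.r : F) = C.u ^ 2 * x₂ + C.r ∧
          (C.u ^ 3 * y₁ + C.u ^ 2 * C.s * x₁ + C.t : F) = W.toAffine.negY (C.u ^ 2 * x₂ + C.r)
        (C.u ^ 3 * y₂ + C.u ^ 2 * C.s * x₂ + C.t)) := by
        rintro ⟨hx, hy⟩
        have hx : x₁ = x₂ := by simpa [hu] using hx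
        subst hx
        exact hxy ⟨rfl, key.1 (by rw [hy]; ring)⟩
      rw [Point.add_some hxy, Point.add_some hxy']
      have hs := slope_variableChange C W hxy h₁.1 h₂.1
      simp only [Point.some.injEq, hs]
      generalize (C • W).toAffine.slope x₁ x₂ y₁ y₂ = m
      simp only [addX, addY, negAddY, negY, variableChange_def, Units.val_inv_eq_inv_val]
      constructor <;> field_simp <;> ring

lemma variableChangeHom_some {x y : F} (h : (C • W).toAffine.Nonsingular x y) :
    variableChangeHom C W (.some x y h) =
      .some _ _ ((nonsingular_variableChange_iff C W x y).1 h) := rfl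

lemma variableChangeHom_injective : Function.Injective (variableChangeHom C W) := by
  rw [injective_iff_map_eq_zero]
  rintro (_ | ⟨x, y, h⟩) e
  · rfl
  · simp [variableChangeHom_some] at e

end VariableChange

end WeierstrassCurve

/-! ### Reduction of torsion points -/

/-- If a monic polynomial over an integrally closed domain splits over the fraction field, then its
roots in every field to which the domain maps lift to roots in the domain. -/
theorem Polynomial.exists_root_of_map_splits {A L k : Type*} [CommRing A] [IsDomain A]
    [IsIntegrallyClosed A] [Field L] [Algebra A L] [IsFractionRing A L] [Field k] (ρ : A →+* k)
    {P : A[X]} (hP : P.Monic) (hs : (P.map (algebraMap A L)).Splits) {α : k}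
    (hα : P.eval₂ ρ α = 0) : ∃ a, P.eval a = 0 ∧ ρ a = α := by
  have hsA : P.Splits := by
    refine hs.of_splits_map_of_injective (IsFractionRing.injective A L) fun x hx => ?_
    have hx0 : P.eval₂ (algebraMap A L) x = 0 := by
      rw [← eval_map]; exact (mem_roots'.1 hx).2
    exact IsIntegrallyClosed.isIntegral_iff.1 ⟨P, hP, hx0⟩
  have h := hsA.eq_prod_roots_of_monic hP
  have h2 : ((P.roots.map fun a => X - C a).prod).eval₂ ρ α = 0 := by rw [← h]; exact hα
  rw [eval₂_multiset_prod, Multiset.map_map, Multiset.prod_eq_zero_iff, Multiset.mem_map] at h2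
  obtain ⟨a, ha, h0⟩ := h2
  refine ⟨a, (mem_roots'.1 ha).2, ?_⟩
  simp [eval₂_sub] at h0
  exact (sub_eq_zero.1 h0).symm

namespace WeierstrassCurve

open WeierstrassCurve.Affine

/-- Where `n` is a unit, the `x`-coordinates of the `n`-torsion points are the roots of a monic
polynomial, simultaneously for all fields over the base ring. -/
theorem exists_monic_nsmul_eq_zero_iff {R : Type*} [CommRing R] (W : WeierstrassCurve R) {n : ℕ}
    (hn : n ≠ 0) (hu : IsUnit (n : R)) : ∃ P : R[X], P.Monic ∧
      ∀ (F : Type u) [Field F] [DecidableEq F] (f : R →+* F) (x y : F)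
        (h : (W.map f).toAffine.Nonsingular x y),
        P.eval₂ f x = 0 ↔ n • Point.some x y h = 0 := by
  obtain ⟨U, V, -, hV, H⟩ := exists_xCoord_nsmul_polynomials W n hn
  obtain ⟨c, hc⟩ := hu.pow 2
  refine ⟨C (↑c⁻¹ : R) * V, ?_, fun F _ _ f x y h => ?_⟩
  · refine monic_of_natDegree_le_of_coeff_eq_one (n ^ 2 - 1)
      ((natDegree_C_mul_le _ _).trans hV.1) ?_
    rw [coeff_C_mul, hV.2, ← hc, Units.inv_mul]
  · rw [eval₂_mul, eval₂_C, mul_eq_zero, or_iff_right, (H F f x y h).eq_zero_iff]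
    exact (c⁻¹.isUnit.map f).ne_zero

section FiberPolynomial

variable {R : Type*} [CommRing R] (W : WeierstrassCurve R)

/-- The monic quadratic polynomial in `Y` whose roots are the `y`-coordinates of the points of `W`
with first coordinate `x`. -/
noncomputable def fiberPolynomial (x : R) : R[X] :=
  X ^ 2 + C (W.a₁ * x + W.a₃) * X - C (x ^ 3 + W.a₂ * x ^ 2 + W.a₄ * x + W.a₆)

lemma monic_fiberPolynomial (x : R) : (W.fiberPolynomial x).Monic := by
  rw [fiberPolynomial]; monicity!

lemma degree_fiberPolynomial [Nontrivial R] (x : R) : (W.fiberPolynomial x).degree = 2 := by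
  rw [fiberPolynomial]; compute_degree!

lemma eval₂_fiberPolynomial_eq_zero_iff {S : Type*} [CommRing S] {f : R →+* S} {x : R} {y : S} :
    (W.fiberPolynomial x).eval₂ f y = 0 ↔ (W.map f).toAffine.Equation (f x) y := by
  rw [equation_iff', fiberPolynomial]
  simp only [eval₂_sub, eval₂_add, eval₂_mul, eval₂_pow, eval₂_X, eval₂_C, map_add, map_mul,
    map_pow, map_a₁, map_a₂, map_a₃, map_a₄, map_a₆]
  refine Eq.congr ?_ rfl
  ring

lemma exists_equation_of_isAlgClosed {M : Type*} [Field M] [IsAlgClosed M] (W : WeierstrassCurve M)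
    (x : M) : ∃ y, W.toAffine.Equation x y := by
  obtain ⟨y, hy⟩ := IsAlgClosed.exists_root (W.fiberPolynomial x)
    (by rw [degree_fiberPolynomial]; decide)
  refine ⟨y, ?_⟩
  have h := (W.eval₂_fiberPolynomial_eq_zero_iff (f := RingHom.id M)).1 hy
  rwa [WeierstrassCurve.map_id] at h

end FiberPolynomial

section Reduction

variable {R : Type*} [CommRing R] {W : WeierstrassCurve R}
  {A L : Type u} [CommRing A] [IsIntegrallyClosed A] [Field L]
  [Algebra A L] [IsFractionRing A L] {g : R →+* A}

/-- Nonzero `n`-torsion points have integral coordinates, for `n` a unit of the base ring: no such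
point reduces to the point at infinity. -/
theorem exists_algebraMap_eq_of_nsmul_eq_zero [DecidableEq L] {n : ℕ} (hn : n ≠ 0)
    (hu : IsUnit (n : R)) {x y : L}
    (h : (W.map ((algebraMap A L).comp g)).toAffine.Nonsingular x y)
    (h0 : n • Point.some x y h = 0) : (∃ a, algebraMap A L a = x) ∧ ∃ b, algebraMap A L b = y := by
  obtain ⟨P, hP, H⟩ := exists_monic_nsmul_eq_zero_iff.{u} W hn hu
  have hx : ∃ a, algebraMap A L a = x := by
    refine IsIntegrallyClosed.isIntegral_iff.1 ⟨P.map g, hP.map g, ?_⟩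
    rw [eval₂_map]
    exact (H L _ x y h).2 h0
  refine ⟨hx, ?_⟩
  obtain ⟨a, rfl⟩ := hx
  refine IsIntegrallyClosed.isIntegral_iff.1 ⟨_, (W.map g).monic_fiberPolynomial a, ?_⟩
  rw [eval₂_fiberPolynomial_eq_zero_iff, WeierstrassCurve.map_map]
  exact h.1

lemma exists_algebraMap_eq_of_mul_add {l : L} {a b : A}
    (h : l ^ 2 + algebraMap A L a * l = algebraMap A L b) : ∃ c, algebraMap A L c = l := by
  refine IsIntegrallyClosed.isIntegral_iff.1 ⟨X ^ 2 + C a * X - C b, by monicity!, ?_⟩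
  simp [eval₂_sub, eval₂_mul, h]

variable {k : Type u} [Field k] {ρ : A →+* k}

omit [IsIntegrallyClosed A] in
lemma Affine.Equation.of_map_algebraMap {a b : A}
    (h : (W.map ((algebraMap A L).comp g)).toAffine.Equation
      (algebraMap A L a) (algebraMap A L b)) :
    (W.map g).toAffine.Equation a b := by
  rw [← WeierstrassCurve.map_map] at h
  exact (map_equation _ (IsFractionRing.injective A L) _ _).1 h

omit [IsIntegrallyClosed A] in
/-- Two numerators and denominators of the slope `l` of the line through `(a₁, b₁)` and
`-(a₂, b₂)`. If the two points have the same reduction, then both denominators reduce to `0`, so that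
an integral slope makes both partial derivatives vanish at the reduced point. -/
lemma not_exists_integral_slope [W.IsElliptic] {a₁ b₁ a₂ b₂ l : A}
    (h : (W.map g).toAffine.Equation a₁ b₁)
    (ha : ρ a₁ = ρ a₂) (hb : ρ b₁ = ρ b₂)
    (hl : l * (a₁ - a₂) = b₁ + b₂ + g W.a₁ * a₂ + g W.a₃)
    (hl' : l * (b₁ - b₂) =
      a₁ ^ 2 + a₁ * a₂ + a₂ ^ 2 + g W.a₂ * (a₁ + a₂) + g W.a₄ - g W.a₁ * b₁) : False := by
  have hl := congrArg ρ hl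
  have hl' := congrArg ρ hl'
  simp only [map_mul, map_sub, map_add, map_pow, ← ha, ← hb] at hl hl'
  have hE : (W.map (ρ.comp g)).toAffine.Equation (ρ a₁) (ρ b₁) := by
    rw [← WeierstrassCurve.map_map]
    exact h.map ρ
  have := ((nonsingular_iff' _ _).1 (equation_iff_nonsingular.1 hE)).2
  simp only [map_a₁, map_a₂, map_a₃, map_a₄, RingHom.comp_apply] at this
  rcases this with h | h
  · exact h (by linear_combination hl')
  · exact h (by linear_combination -hl)

omit [IsIntegrallyClosed A] in
/-- The line through `P` and `-Q` has no integral slope if `P ≠ Q` have the same reduction. -/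
lemma algebraMap_ne_slope_of_reduction_eq [W.IsElliptic] [IsDomain A] [DecidableEq L]
    {a₁ b₁ a₂ b₂ l : A}
    (h₁ : (W.map ((algebraMap A L).comp g)).toAffine.Equation
      (algebraMap A L a₁) (algebraMap A L b₁))
    (h₂ : (W.map ((algebraMap A L).comp g)).toAffine.Equation
      (algebraMap A L a₂) (algebraMap A L b₂))
    (ha : ρ a₁ = ρ a₂) (hb : ρ b₁ = ρ b₂) (hne : ¬(a₁ = a₂ ∧ b₁ = b₂)) :
    algebraMap A L l ≠ (W.map ((algebraMap A L).comp g)).toAffine.slope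
      (algebraMap A L a₁) (algebraMap A L a₂) (algebraMap A L b₁)
      ((W.map ((algebraMap A L).comp g)).toAffine.negY (algebraMap A L a₂) (algebraMap A L b₂)) := by
  intro hm
  have inj := IsFractionRing.injective A L
  have e₁ := (equation_iff _ _).1 (Affine.Equation.of_map_algebraMap h₁)
  have e₂ := (equation_iff _ _).1 (Affine.Equation.of_map_algebraMap h₂)
  simp only [map_a₁, map_a₂, map_a₃, map_a₄, map_a₆] at e₁ e₂
  by_cases hx : a₁ = a₂
  · subst hx
    have hb12 : b₁ ≠ b₂ := fun e => hne ⟨rfl, e⟩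
    -- the two points are opposite
    have hbb : b₁ + b₂ + g W.a₁ * a₁ + g W.a₃ = 0 := by
      refine (mul_eq_zero.1 ?_).resolve_left (sub_ne_zero.2 hb12)
      linear_combination e₁ - e₂
    have hbL : algebraMap A L b₁ + algebraMap A L b₂ + algebraMap A L (g W.a₁) * algebraMap A L a₁ +
        algebraMap A L (g W.a₃) = 0 := by
      rw [← map_mul, ← map_add, ← map_add, ← map_add, hbb, map_zero]
    have hd : algebraMap A L b₁ - algebraMap A L b₂ ≠ 0 := sub_ne_zero.2 (inj.ne hb12)
    have hn : (W.map ((algebraMap A L).comp g)).toAffine.negY (algebraMap A L a₁)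
        (algebraMap A L b₂) = algebraMap A L b₁ := by
      rw [negY, map_a₁, map_a₃, RingHom.comp_apply, RingHom.comp_apply]
      linear_combination -hbL
    have hn' : (W.map ((algebraMap A L).comp g)).toAffine.negY (algebraMap A L a₁)
        (algebraMap A L b₁) = algebraMap A L b₂ := by
      rw [← hn, negY_negY]
    rw [hn, slope_of_Y_ne rfl (by rw [hn']; exact inj.ne hb12), hn', eq_div_iff hd] at hm
    refine not_exists_integral_slope (l := l) (.of_map_algebraMap h₁) ha hb
      (by rw [hbb, sub_self, mul_zero]) (inj ?_)
    rw [map_mul, map_sub, hm]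
    simp only [map_a₁, map_a₂, map_a₄, RingHom.comp_apply, map_add, map_sub, map_mul, map_pow]
    ring
  · have hd : algebraMap A L (a₁ - a₂) ≠ 0 := (map_ne_zero_iff _ inj).2 (sub_ne_zero.2 hx)
    rw [slope_of_X_ne (inj.ne hx), ← map_sub, eq_div_iff hd, negY] at hm
    have h3 : l * (a₁ - a₂) = b₁ + b₂ + g W.a₁ * a₂ + g W.a₃ := by
      apply inj
      rw [map_mul, hm]
      simp only [map_a₁, map_a₃, RingHom.comp_apply, map_add, map_mul]
      ring
    refine not_exists_integral_slope (.of_map_algebraMap h₁) ha hb h3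
      (mul_right_cancel₀ (sub_ne_zero.2 hx) ?_)
    linear_combination (b₁ - b₂) * h3 + e₁ - e₂

/-- Reduction is injective on nonzero `n`-torsion points, for `n` a unit of the base ring. -/
theorem eq_of_reduction_eq [IsDomain A] [W.IsElliptic] [DecidableEq L] {n : ℕ} (hn : n ≠ 0)
    (hu : IsUnit (n : R))
    {a₁ b₁ a₂ b₂ : A}
    (h₁ : (W.map ((algebraMap A L).comp g)).toAffine.Nonsingular
      (algebraMap A L a₁) (algebraMap A L b₁))
    (h₂ : (W.map ((algebraMap A L).comp g)).toAffine.Nonsingular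
      (algebraMap A L a₂) (algebraMap A L b₂))
    (h₁0 : n • Point.some _ _ h₁ = 0) (h₂0 : n • Point.some _ _ h₂ = 0)
    (ha : ρ a₁ = ρ a₂) (hb : ρ b₁ = ρ b₂) : a₁ = a₂ ∧ b₁ = b₂ := by
  by_contra hne
  have inj := IsFractionRing.injective A L
  -- the difference of the points is torsion, so its `x`-coordinate and hence the slope are integral
  have hD : n • (Point.some _ _ h₁ + - Point.some _ _ h₂) = 0 := by
    rw [nsmul_add, neg_nsmul, h₁0, h₂0, neg_zero, add_zero]
  rw [Point.neg_some,
    Point.add_some (by rw [negY_negY]; exact fun h => hne ⟨inj h.1, inj h.2⟩)] at hD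
  obtain ⟨⟨c, hc⟩, -⟩ := exists_algebraMap_eq_of_nsmul_eq_zero hn hu _ hD
  obtain ⟨l, hl⟩ := exists_algebraMap_eq_of_mul_add (a := g W.a₁) (b := c + g W.a₂ + a₁ + a₂)
    (l := (W.map ((algebraMap A L).comp g)).toAffine.slope
      (algebraMap A L a₁) (algebraMap A L a₂) (algebraMap A L b₁)
      ((W.map ((algebraMap A L).comp g)).toAffine.negY (algebraMap A L a₂) (algebraMap A L b₂))) (by
    simp only [map_add, hc, addX, map_a₁, map_a₂, RingHom.comp_apply]
    ring)
  exact algebraMap_ne_slope_of_reduction_eq h₁.1 h₂.1 ha hb hne hl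

variable {K : Type u} [Field K] [DecidableEq K] {r : R →+* K} {ι : K →+* k}

omit [IsIntegrallyClosed A] in
/-- The reduction of an integral `n`-torsion point is `n`-torsion. The field `K` of coefficients of
the reduced curve may be smaller than the field `k` in which the reduction takes place. -/
theorem nsmul_reduction_eq_zero [W.IsElliptic] [DecidableEq L] {n : ℕ} (hn : n ≠ 0)
    (hu : IsUnit (n : R))
    (hι : ι.comp r = ρ.comp g) {a b : A}
    (h : (W.map ((algebraMap A L).comp g)).toAffine.Nonsingular
      (algebraMap A L a) (algebraMap A L b))
    (h0 : n • Point.some _ _ h = 0) {α β : K} (hα : ι α = ρ a) (hβ : ι β = ρ b) :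
    ∃ h' : (W.map r).toAffine.Nonsingular α β, n • Point.some _ _ h' = 0 := by
  obtain ⟨P, hP, H⟩ := exists_monic_nsmul_eq_zero_iff.{u} W hn hu
  have hE : (W.map r).toAffine.Equation α β := by
    have : ((W.map g).map ρ).toAffine.Equation (ρ a) (ρ b) :=
      (Affine.Equation.of_map_algebraMap h.1).map ρ
    rw [WeierstrassCurve.map_map, ← hι, ← hα, ← hβ, ← WeierstrassCurve.map_map,
      map_equation _ ι.injective] at this
    exact this
  refine ⟨equation_iff_nonsingular.1 hE, ?_⟩
  rw [← H] at h0 ⊢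
  apply ι.injective
  rw [hom_eval₂, map_zero, hι, hα, ← hom_eval₂, ← map_zero ρ]
  congr 1
  apply IsFractionRing.injective A L
  rw [hom_eval₂, h0, map_zero]

/-- Every `n`-torsion point of the reduced curve lifts to an `n`-torsion point over `L`, if `L`
contains the coordinates of all `n`-torsion points. -/
theorem exists_lift_of_nsmul_eq_zero [IsDomain A] [W.IsElliptic] [DecidableEq L] {n : ℕ}
    (hn : n ≠ 0) (hu : IsUnit (n : R))
    (hι : ι.comp r = ρ.comp g) {M : Type u} [Field M] [DecidableEq M] [IsAlgClosed M] (j : L →+* M)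
    (hj : ∀ (x y : M) (h : (W.map (j.comp ((algebraMap A L).comp g))).toAffine.Nonsingular x y),
      n • Point.some x y h = 0 → x ∈ j.range ∧ y ∈ j.range)
    {α β : K} (h : (W.map r).toAffine.Nonsingular α β) (h0 : n • Point.some α β h = 0) :
    ∃ (a b : A) (h' : (W.map ((algebraMap A L).comp g)).toAffine.Nonsingular
      (algebraMap A L a) (algebraMap A L b)), n • Point.some _ _ h' = 0 ∧ ρ a = ι α ∧ ρ b = ι β := by
  obtain ⟨P, hP, H⟩ := exists_monic_nsmul_eq_zero_iff.{u} W hn hu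
  -- above every root `x` of `P` in `M` there is a point, which is torsion
  have hroot : ∀ x : M, P.eval₂ (j.comp ((algebraMap A L).comp g)) x = 0 → x ∈ j.range := by
    intro x hx
    obtain ⟨y, hy⟩ := (W.map (j.comp ((algebraMap A L).comp g))).exists_equation_of_isAlgClosed x
    exact (hj x y (equation_iff_nonsingular.1 hy) ((H _ _ _ _ _).1 hx)).1
  have hPs : ((P.map g).map (algebraMap A L)).Splits := by
    refine .of_splits_map j (IsAlgClosed.splits _) fun x hx => hroot x ?_
    have := (mem_roots'.1 hx).2
    rwa [IsRoot, eval_map, eval₂_map, eval₂_map] at this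
  obtain ⟨a, haP, haα⟩ := exists_root_of_map_splits ρ (hP.map g) hPs (α := ι α) (by
    rw [eval₂_map, ← hι, ← hom_eval₂, (H _ _ _ _ h).2 h0, map_zero])
  have haL : P.eval₂ ((algebraMap A L).comp g) (algebraMap A L a) = 0 := by
    rw [← hom_eval₂, ← eval_map, haP, map_zero]
  have hQs : (((W.map g).fiberPolynomial a).map (algebraMap A L)).Splits := by
    refine .of_splits_map j (IsAlgClosed.splits _) fun y hy => ?_
    have hy := (mem_roots'.1 hy).2
    rw [IsRoot, eval_map, eval₂_map, eval₂_fiberPolynomial_eq_zero_iff,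
      WeierstrassCurve.map_map] at hy
    refine (hj _ y (equation_iff_nonsingular.1 hy) ((H _ _ _ _ _).1 ?_)).2
    rw [RingHom.comp_apply, ← hom_eval₂, haL, map_zero]
  obtain ⟨b, hbE, hbβ⟩ := exists_root_of_map_splits ρ ((W.map g).monic_fiberPolynomial a) hQs
    (α := ι β) (by
      rw [eval₂_fiberPolynomial_eq_zero_iff, WeierstrassCurve.map_map, haα, ← hι,
        ← WeierstrassCurve.map_map]
      exact h.1.map ι)
  have hE : (W.map ((algebraMap A L).comp g)).toAffine.Equation
      (algebraMap A L a) (algebraMap A L b) := by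
    rw [← WeierstrassCurve.map_map, ← eval₂_fiberPolynomial_eq_zero_iff, eval₂_at_apply, hbE,
      map_zero]
  exact ⟨a, b, equation_iff_nonsingular.1 hE, (H _ _ _ _ _).1 haL, haα, hbβ⟩

end Reduction

end WeierstrassCurve

/-! ### The local ring at a prime over `p` -/

section
variable (L : Type*) [Field L] [Algebra ℚ L] [Algebra.IsAlgebraic ℚ L]

/-- `L` need not be of finite degree over `ℚ`. -/
instance NumberField.RingOfIntegers.isFractionRing_of_isAlgebraic : IsFractionRing (𝓞 L) L :=
  have : Algebra.IsAlgebraic ℤ L := (IsFractionRing.comap_isAlgebraic_iff (K := ℚ)).2 ‹_›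
  integralClosure.isFractionRing_of_algebraic (A := ℤ) (L := L) fun x hx => by
    have := charZero_of_injective_algebraMap (algebraMap ℚ L).injective
    simpa using hx

instance NumberField.RingOfIntegers.isIntegrallyClosed_of_isAlgebraic : IsIntegrallyClosed (𝓞 L) :=
  (isIntegrallyClosed_iff_isIntegrallyClosedIn L).2
    (inferInstanceAs (IsIntegrallyClosedIn (integralClosure ℤ L) L))
end

namespace WeierstrassCurve

variable {p : ℕ} [Fact p.Prime]

lemma ratLocal.den_not_dvd (r : ratLocal p) : ¬ p ∣ (r : ℚ).den :=
  Rat.padicValuation_le_one_iff.1 r.2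

lemma ratLocal.isUnit_iff {r : ratLocal p} : IsUnit r ↔ ¬ (p : ℤ) ∣ (r : ℚ).num := by
  have hint : (Rat.padicValuation p).Integers (ratLocal p) :=
    Valuation.integer.integers (Rat.padicValuation p)
  have hden : Int.padicValuation p (r : ℚ).den = 1 :=
    Int.padicValuation_eq_one_iff.2 (Int.natCast_dvd_natCast.not.2 (den_not_dvd r))
  rw [hint.isUnit_iff_valuation_eq_one, ← Int.padicValuation_eq_one_iff]
  change Rat.padicValuation p (r : ℚ) = 1 ↔ _
  rw [← Rat.padicValuation_cast] at hden ⊢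
  nth_rw 1 [← Rat.num_div_den (r : ℚ)]
  rw [Int.cast_natCast] at hden
  rw [map_div₀, hden, div_one]

lemma ratLocal.isUnit_natCast {n : ℕ} : IsUnit (n : ratLocal p) ↔ ¬ p ∣ n := by
  rw [isUnit_iff]
  have : ((n : ratLocal p) : ℚ) = n := rfl
  rw [this, Rat.num_natCast, Int.natCast_dvd_natCast]

instance ratLocal.charP_residueField : CharP (IsLocalRing.ResidueField (ratLocal p)) p := by
  refine ⟨fun n => ?_⟩
  rw [← map_natCast (IsLocalRing.residue (ratLocal p)), IsLocalRing.residue_eq_zero_iff,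
    IsLocalRing.mem_maximalIdeal, mem_nonunits_iff, isUnit_natCast, not_not]

lemma ratLocal.castHom_residueField_surjective : Function.Surjective
    (ZMod.castHom (dvd_refl p) (IsLocalRing.ResidueField (ratLocal p))) := by
  intro x
  obtain ⟨r, rfl⟩ := IsLocalRing.residue_surjective x
  have h : IsLocalRing.residue (ratLocal p) r * ((r : ℚ).den : ℕ) = ((r : ℚ).num : ℤ) := by
    rw [← map_natCast (IsLocalRing.residue (ratLocal p)),
      ← map_intCast (IsLocalRing.residue (ratLocal p)), ← map_mul]
    congr 1
    exact Subtype.ext (Rat.mul_den_eq_num _)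
  have hd : (((r : ℚ).den : ℕ) : IsLocalRing.ResidueField (ratLocal p)) ≠ 0 := by
    rw [Ne, CharP.cast_eq_zero_iff _ p]
    exact den_not_dvd r
  exact ⟨((r : ℚ).num : ℤ) / ((r : ℚ).den : ℕ), by
    rw [map_div₀, map_intCast, map_natCast, ← h, mul_div_cancel_right₀ _ hd]⟩

instance ratLocal.finite_residueField : Finite (IsLocalRing.ResidueField (ratLocal p)) :=
  Finite.of_surjective _ castHom_residueField_surjective

lemma ratLocal.residueField_pow_eq_self (x : IsLocalRing.ResidueField (ratLocal p)) :
    x ^ p = x := by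
  obtain ⟨z, rfl⟩ := castHom_residueField_surjective x
  rw [← map_pow, ZMod.pow_card]

/-- The local ring `A` of `L` at `𝔓`, with its map `ρ` to the residue field `k` of `𝔓`, extends the
reduction map of `ℤ_(p)`, and a Frobenius element at `𝔓` acts through `ρ` as the `p`-th power. -/
lemma exists_integrallyClosed_reduction {L : Type} [Field L] [Algebra ℚ L]
    [Algebra.IsAlgebraic ℚ L]
    (𝔓 : Ideal (𝓞 L)) [𝔓.IsPrime] [h𝔓 : 𝔓.LiesOver (Ideal.span {(p : ℤ)})]
    (σ : Gal(L/ℚ)) (hσ : IsArithFrobAt ℤ σ 𝔓) :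
    ∃ (A : Type) (_ : CommRing A) (_ : IsDomain A) (_ : IsIntegrallyClosed A) (_ : Algebra A L)
      (_ : IsFractionRing A L) (k : Type) (_ : Field k) (g : ratLocal p →+* A) (ρ : A →+* k)
      (ι : IsLocalRing.ResidueField (ratLocal p) →+* k),
      ι.comp (IsLocalRing.residue (ratLocal p)) = ρ.comp g ∧
      (algebraMap A L).comp g = (algebraMap ℚ L).comp (ratLocal p).subtype ∧
      ∀ a b : A, σ (algebraMap A L a) = algebraMap A L b → ρ b = ρ a ^ p := by
  have hS : 𝔓.primeCompl ≤ nonZeroDivisors (𝓞 L) := 𝔓.primeCompl_le_nonZeroDivisors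
  let A := Localization.subalgebra.ofField L 𝔓.primeCompl hS
  have hunit : ∀ s : 𝔓.primeCompl, IsUnit (algebraMap (𝓞 L) 𝔓.ResidueField s) := fun s =>
    IsUnit.mk0 _ (mt Ideal.algebraMap_residueField_eq_zero.1 s.2)
  let ρ : A →+* 𝔓.ResidueField := IsLocalization.lift hunit
  have hρ : ∀ x : 𝓞 L, ρ (algebraMap (𝓞 L) A x) = algebraMap (𝓞 L) 𝔓.ResidueField x :=
    IsLocalization.lift_eq hunit
  have hpm : ∀ n : ℤ, (n : 𝓞 L) ∈ 𝔓 ↔ (p : ℤ) ∣ n := fun n => by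
    rw [← Ideal.mem_span_singleton, h𝔓.over, Ideal.under_def, Ideal.mem_comap]
    rfl
  have hg : ∀ r : ratLocal p, algebraMap ℚ L r ∈ A := fun r =>
    show ∃ a s, ∃ _ : s ∈ 𝔓.primeCompl,
        algebraMap ℚ L r = algebraMap (𝓞 L) L a * (algebraMap (𝓞 L) L s)⁻¹ from
      ⟨((r : ℚ).num : ℤ), ((r : ℚ).den : ℤ), by
        rw [Ideal.mem_primeCompl_iff, hpm, Int.natCast_dvd_natCast]
        exact ratLocal.den_not_dvd r, by
        conv_lhs => rw [← Rat.num_div_den (r : ℚ)]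
        rw [map_div₀, map_intCast, map_natCast, map_intCast, map_intCast, Int.cast_natCast,
          div_eq_mul_inv]⟩
  let g : ratLocal p →+* A := ((algebraMap ℚ L).comp (ratLocal p).subtype).codRestrict A hg
  have hgn : ∀ (r : ratLocal p), g r * algebraMap (𝓞 L) A ((r : ℚ).den : ℤ) =
      algebraMap (𝓞 L) A ((r : ℚ).num : ℤ) := fun r => by
    apply IsFractionRing.injective A L
    rw [map_mul]
    change algebraMap ℚ L r * algebraMap (𝓞 L) L _ = algebraMap (𝓞 L) L _
    rw [map_intCast, map_intCast, ← map_intCast (algebraMap ℚ L), ← map_intCast (algebraMap ℚ L),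
      ← map_mul, Int.cast_natCast, Rat.mul_den_eq_num]
  have hloc : IsLocalHom (ρ.comp g) := ⟨fun r hr => by
    rw [ratLocal.isUnit_iff, ← hpm, ← Ideal.algebraMap_residueField_eq_zero, ← hρ, ← hgn, map_mul,
      hρ, mul_eq_zero, not_or, Ideal.algebraMap_residueField_eq_zero, hpm, Int.natCast_dvd_natCast]
    exact ⟨hr.ne_zero, ratLocal.den_not_dvd r⟩⟩
  have hcard : Nat.card (ℤ ⧸ 𝔓.under ℤ) = p := by
    rw [← h𝔓.over, Nat.card_congr (Int.quotientSpanNatEquivZMod p).toEquiv, Nat.card_zmod]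
  refine ⟨A, inferInstance, inferInstance,
    isIntegrallyClosed_of_isLocalization _ 𝔓.primeCompl hS, inferInstance, inferInstance,
    𝔓.ResidueField, inferInstance, g, ρ, IsLocalRing.ResidueField.lift (ρ.comp g), ?_, rfl, ?_⟩
  · ext r; rfl
  · intro a b hab
    obtain ⟨⟨n, d⟩, hnd⟩ := IsLocalization.surj 𝔓.primeCompl a
    have h1 : b * algebraMap (𝓞 L) A (σ • (d : 𝓞 L)) = algebraMap (𝓞 L) A (σ • n) := by
      apply IsFractionRing.injective A L
      have := congrArg (fun z => σ (algebraMap A L z)) hnd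
      simp only [map_mul, hab] at this ⊢
      exact this
    have hfrob : ∀ x : 𝓞 L, ρ (algebraMap (𝓞 L) A (σ • x)) = ρ (algebraMap (𝓞 L) A x) ^ p := by
      intro x
      rw [hρ, hρ, ← map_pow, ← sub_eq_zero, ← map_sub, Ideal.algebraMap_residueField_eq_zero]
      have := hσ x
      rwa [hcard] at this
    have h2 := congrArg ρ h1
    have h3 := congrArg (ρ · ^ p) hnd
    simp only [map_mul, hfrob, mul_pow] at h2 h3
    rw [← h3] at h2
    refine mul_right_cancel₀ (pow_ne_zero p ?_) h2
    rw [hρ]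
    exact (hunit d).ne_zero

end WeierstrassCurve

/-! ### Fixed torsion points -/

namespace WeierstrassCurve

open WeierstrassCurve.Affine

instance Affine.Point.finite {F : Type*} [Field F] [Finite F] (W : WeierstrassCurve F) :
    Finite W.toAffine.Point :=
  have : Finite (WithZero {xy : F × F // W.toAffine.Nonsingular xy.1 xy.2}) :=
    inferInstanceAs (Finite (Option _))
  .of_equiv _ W.toAffine.nonsingularPointEquiv.symm

/-- Field homomorphisms over the base ring take `n`-torsion points to `n`-torsion points. -/
lemma exists_nsmul_map_eq_zero {R : Type*} [CommRing R] {W : WeierstrassCurve R} {n : ℕ}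
    (hn : n ≠ 0) (hu : IsUnit (n : R)) {F F' : Type u} [Field F] [Field F'] [DecidableEq F]
    [DecidableEq F'] {f : R →+* F} {f' : R →+* F'} (τ : F →+* F') (hτ : τ.comp f = f') {x y : F}
    (h : (W.map f).toAffine.Nonsingular x y) (h0 : n • Point.some x y h = 0) :
    ∃ h' : (W.map f').toAffine.Nonsingular (τ x) (τ y), n • Point.some _ _ h' = 0 := by
  subst hτ
  obtain ⟨P, -, H⟩ := exists_monic_nsmul_eq_zero_iff.{u} W hn hu
  have h' : (W.map (τ.comp f)).toAffine.Nonsingular (τ x) (τ y) := by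
    rw [← WeierstrassCurve.map_map]
    exact (map_nonsingular _ τ.injective _ _).2 h
  refine ⟨h', (H _ _ _ _ h').1 ?_⟩
  rw [← hom_eval₂, (H _ _ _ _ h).2 h0, map_zero]

lemma nsmul_some_eq_zero_iff_of_variableChange {F : Type*} [Field F] [DecidableEq F]
    {W W' : WeierstrassCurve F} {C : VariableChange F} (hW : W' = C • W) (n : ℕ) {x y : F}
    (h : W'.toAffine.Nonsingular x y)
    (h' : W.toAffine.Nonsingular (C.u ^ 2 * x + C.r) (C.u ^ 3 * y + C.u ^ 2 * C.s * x + C.t)) :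
    n • Point.some x y h = 0 ↔ n • Point.some _ _ h' = 0 := by
  subst hW
  rw [← (injective_iff_map_eq_zero' _).1 (variableChangeHom_injective C W), map_nsmul]
  rfl

lemma exists_fixed_nsmul_eq_zero_iff_of_variableChange {K L : Type*} [Field K] [Field L]
    [DecidableEq L] [Algebra K L] (σ : Gal(L/K)) {C : VariableChange K} {W W' : WeierstrassCurve L}
    (hW : W' = C.map (algebraMap K L) • W) {n : ℕ} :
    (∃ (x y : L) (h : W'.toAffine.Nonsingular x y),
      n • Point.some x y h = 0 ∧ σ x = x ∧ σ y = y) ↔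
    ∃ (x y : L) (h : W.toAffine.Nonsingular x y),
      n • Point.some x y h = 0 ∧ σ x = x ∧ σ y = y := by
  have hu : algebraMap K L C.u ≠ 0 := (_root_.map_ne_zero _).2 C.u.ne_zero
  constructor
  · rintro ⟨x, y, h, h0, hx, hy⟩
    have h' := h
    rw [hW, nonsingular_variableChange_iff] at h'
    refine ⟨_, _, h', (nsmul_some_eq_zero_iff_of_variableChange hW n h h').1 h0, ?_, ?_⟩ <;>
    simp [VariableChange.map, hx, hy]
  · rintro ⟨X, Y, h, h0, hX, hY⟩
    obtain ⟨x, rfl⟩ : ∃ x, X = algebraMap K L C.u ^ 2 * x + algebraMap K L C.r :=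
      ⟨(X - algebraMap K L C.r) / algebraMap K L C.u ^ 2, by field_simp; ring⟩
    obtain ⟨y, rfl⟩ : ∃ y, Y = algebraMap K L C.u ^ 3 * y +
        algebraMap K L C.u ^ 2 * algebraMap K L C.s * x + algebraMap K L C.t :=
      ⟨(Y - algebraMap K L C.u ^ 2 * algebraMap K L C.s * x - algebraMap K L C.t) /
        algebraMap K L C.u ^ 3, by field_simp; ring⟩
    have h' : W'.toAffine.Nonsingular x y := by
      rw [hW, nonsingular_variableChange_iff]
      exact h
    have hx : σ x = x := by simpa [hu] using hX
    exact ⟨x, y, h', (nsmul_some_eq_zero_iff_of_variableChange hW n h' h).2 h0, hx,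
      by simpa [hu, hx] using hY⟩

section Frobenius

variable {p ℓ : ℕ} [Fact p.Prime] [Fact ℓ.Prime]

/-- The theorem for an elliptic curve over `ℤ_(p)`, in terms of coordinates: the reduced curve has a
nonzero `ℓ`-torsion point over `𝔽_p` if and only if a Frobenius element at `𝔓` fixes a nonzero
`ℓ`-torsion point over `L`. -/
theorem dvd_card_point_iff_exists_fixed (hpℓ : p ≠ ℓ) {W : WeierstrassCurve (ratLocal p)}
    [W.IsElliptic] {L : Type} [Field L] [DecidableEq L] [Algebra ℚ L] [Algebra.IsAlgebraic ℚ L]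
    (j : L →ₐ[ℚ] QBar)
    (hj : ∀ (x y : QBar)
      (h : (W.map ((algebraMap ℚ QBar).comp (ratLocal p).subtype)).toAffine.Nonsingular x y),
      ℓ • Point.some x y h = 0 → x ∈ j.range ∧ y ∈ j.range)
    (𝔓 : Ideal (𝓞 L)) [𝔓.IsPrime] [𝔓.LiesOver (Ideal.span {(p : ℤ)})]
    (σ : Gal(L/ℚ)) (hσ : IsArithFrobAt ℤ σ 𝔓) :
    ℓ ∣ Nat.card (W.map (IsLocalRing.residue (ratLocal p))).toAffine.Point ↔
      ∃ (x y : L)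
        (h : (W.map ((algebraMap ℚ L).comp (ratLocal p).subtype)).toAffine.Nonsingular x y),
        ℓ • Point.some x y h = 0 ∧ σ x = x ∧ σ y = y := by
  classical
  obtain ⟨A, _, _, _, _, _, k, _, g, ρ, ι, hι, hg, hfrob⟩ :=
    exists_integrallyClosed_reduction (p := p) 𝔓 σ hσ
  have hℓ : ℓ.Prime := Fact.out
  have hn : ℓ ≠ 0 := hℓ.ne_zero
  have hu : IsUnit (ℓ : ratLocal p) := ratLocal.isUnit_natCast.2 fun h =>
    hpℓ ((Nat.prime_dvd_prime_iff_eq Fact.out hℓ).1 h)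
  have : CharP k p := charP_of_injective_ringHom ι.injective p
  rw [← hg]
  constructor
  · intro hdvd
    obtain ⟨Q, hQ⟩ := exists_prime_addOrderOf_dvd_card' ℓ hdvd
    have hQ0 : ℓ • Q = 0 := hQ ▸ addOrderOf_nsmul_eq_zero Q
    rcases Q with _ | ⟨α, β, h⟩
    · exact absurd (hQ.symm.trans addOrderOf_zero) hℓ.one_lt.ne'
    obtain ⟨a, b, h', h0, ha, hb⟩ := exists_lift_of_nsmul_eq_zero hn hu hι (j : L →+* QBar) (by
      rw [hg, ← RingHom.comp_assoc, AlgHom.comp_algebraMap]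
      exact hj) h hQ0
    obtain ⟨hσ', hσ0⟩ := exists_nsmul_map_eq_zero hn hu (σ : L →+* L)
      (f' := (algebraMap A L).comp g) (by
        rw [hg, ← RingHom.comp_assoc]
        congr 1
        exact σ.toAlgHom.comp_algebraMap) h' h0
    obtain ⟨⟨a', ha'⟩, ⟨b', hb'⟩⟩ := exists_algebraMap_eq_of_nsmul_eq_zero hn hu hσ' hσ0
    simp only [← ha', ← hb'] at hσ' hσ0
    -- the conjugate of the lift has the same reduction, as that is defined over `𝔽_p`
    have key := eq_of_reduction_eq (ρ := ρ) hn hu hσ' h' hσ0 h0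
      (by rw [hfrob a a' ha'.symm, ha, ← map_pow, ratLocal.residueField_pow_eq_self])
      (by rw [hfrob b b' hb'.symm, hb, ← map_pow, ratLocal.residueField_pow_eq_self])
    exact ⟨_, _, h', h0, by rw [key.1] at ha'; exact ha'.symm,
      by rw [key.2] at hb'; exact hb'.symm⟩
  · rintro ⟨x, y, h, h0, hx, hy⟩
    obtain ⟨⟨a, rfl⟩, ⟨b, rfl⟩⟩ := exists_algebraMap_eq_of_nsmul_eq_zero hn hu h h0
    -- a fixed point has coordinates with `x ^ p = x` modulo `𝔓`, so its reduction is over `𝔽_p`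
    obtain ⟨m, hm⟩ := (mem_bot_iff_intCast p k).1
      ((Subfield.mem_bot_iff_pow_eq_self k p).2 (hfrob a a hx).symm)
    obtain ⟨m', hm'⟩ := (mem_bot_iff_intCast p k).1
      ((Subfield.mem_bot_iff_pow_eq_self k p).2 (hfrob b b hy).symm)
    obtain ⟨h', h0'⟩ := nsmul_reduction_eq_zero hn hu hι h h0 (α := m) (β := m')
      (by rw [map_intCast, hm]) (by rw [map_intCast, hm'])
    rw [← addOrderOf_eq_prime h0' (Point.some_ne_zero h')]
    exact addOrderOf_dvd_natCard _

variable {E : WeierstrassCurve ℚ}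

/-- The eigenvalue `1` on `E[ℓ]` means a fixed point in `ℚ(E[ℓ])`-coordinates. -/
lemma hasEigenvalue_torsionRep_iff (σ : Gal(E.torsionField ℓ/ℚ)) :
    Module.End.HasEigenvalue
        (E.torsionRep ℓ σ : Module.End (ZMod ℓ) (E.torsionPoints ℓ QBar)) 1 ↔
      ∃ (x y : E.torsionField ℓ) (h : (E.baseChange (E.torsionField ℓ)).toAffine.Nonsingular x y),
        ℓ • Point.some x y h = 0 ∧ σ x = x ∧ σ y = y := by
  have hconj : ∀ Q, (E.torsionRep ℓ σ).1 (E.torsionFieldEquiv ℓ Q) =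
      E.torsionFieldEquiv ℓ (E.torsionAction ℓ _ σ Q) := fun Q => by
    change E.torsionFieldEquiv ℓ (E.torsionAction ℓ _ σ
      ((E.torsionFieldEquiv ℓ).symm (E.torsionFieldEquiv ℓ Q))) = _
    rw [LinearEquiv.symm_apply_apply]
  constructor
  · intro h
    obtain ⟨v, hv⟩ := h.exists_hasEigenvector
    have hv1 := hv.apply_eq_smul
    have hv0 := hv.2
    obtain ⟨Q, rfl⟩ := (E.torsionFieldEquiv ℓ).surjective v
    rw [one_smul, hconj] at hv1
    have hQ := (E.torsionFieldEquiv ℓ).injective hv1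
    obtain ⟨_ | ⟨x, y, hxy⟩, hQm⟩ := Q
    · exact absurd (map_zero _) hv0
    · have := congrArg Subtype.val hQ
      have h2 := (Point.some.injEq _ _ _ _ _ _).mp this
      exact ⟨x, y, hxy, AddSubgroup.torsionBy.nsmul_iff.1 hQm, h2.1, h2.2⟩
  · rintro ⟨x, y, h, h0, hx, hy⟩
    let Q : E.torsionPoints ℓ (E.torsionField ℓ) :=
      ⟨.some x y h, AddSubgroup.torsionBy.nsmul_iff.2 h0⟩
    refine Module.End.hasEigenvalue_of_hasEigenvector (x := E.torsionFieldEquiv ℓ Q) ?_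
    rw [Module.End.hasEigenvector_iff, Module.End.mem_eigenspace_iff]
    refine ⟨?_, ?_⟩
    · rw [one_smul, hconj]
      congr 1
      exact Subtype.ext ((Point.some.injEq _ _ _ _ _ _).mpr ⟨hx, hy⟩)
    · rw [Ne, LinearEquiv.map_eq_zero_iff]
      exact fun e => Point.some_ne_zero h (congrArg Subtype.val e)

lemma mem_torsionField_of_variableChange (E : WeierstrassCurve ℚ) {n : ℕ} (C : VariableChange ℚ)
    {x y : QBar}
    (hX : (C.map (algebraMap ℚ QBar)).u ^ 2 * x + (C.map (algebraMap ℚ QBar)).r ∈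
      E.torsionField n)
    (hY : (C.map (algebraMap ℚ QBar)).u ^ 3 * y +
      (C.map (algebraMap ℚ QBar)).u ^ 2 * (C.map (algebraMap ℚ QBar)).s * x +
      (C.map (algebraMap ℚ QBar)).t ∈ E.torsionField n) :
    x ∈ (E.torsionField n).val.range ∧ y ∈ (E.torsionField n).val.range := by
  rw [IntermediateField.range_val]
  have hc : ∀ q : ℚ, algebraMap ℚ QBar q ∈ E.torsionField n := fun q =>
    IntermediateField.algebraMap_mem _ q
  have hu : algebraMap ℚ QBar C.u ≠ 0 := (_root_.map_ne_zero _).2 C.u.ne_zero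
  change algebraMap ℚ QBar C.u ^ 2 * x + algebraMap ℚ QBar C.r ∈ _ at hX
  change algebraMap ℚ QBar C.u ^ 3 * y + algebraMap ℚ QBar C.u ^ 2 * algebraMap ℚ QBar C.s * x +
    algebraMap ℚ QBar C.t ∈ _ at hY
  have hx : x ∈ E.torsionField n := by
    have := div_mem (sub_mem hX (hc C.r)) (pow_mem (hc C.u) 2)
    rwa [add_sub_cancel_right, mul_div_cancel_left₀ _ (pow_ne_zero 2 hu)] at this
  refine ⟨hx, ?_⟩
  have := div_mem (sub_mem (sub_mem hY (hc C.t))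
    (mul_mem (mul_mem (pow_mem (hc C.u) 2) (hc C.s)) hx)) (pow_mem (hc C.u) 3)
  rwa [add_sub_cancel_right, add_sub_cancel_right,
    mul_div_cancel_left₀ _ (pow_ne_zero 3 hu)] at this

end Frobenius

end WeierstrassCurve

end

theorem proposition3p2 (E : WeierstrassCurve ℚ) [E.IsElliptic] (ℓ p : ℕ) [Fact ℓ.Prime]
    [Fact p.Prime] (hpℓ : p ≠ ℓ) (hgood : E.HasGoodReductionAt p)
    (𝔓 : Ideal (𝓞 (E.torsionField ℓ))) [𝔓.IsPrime] [𝔓.LiesOver (Ideal.span {(p : ℤ)})]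
    (σ : Gal(E.torsionField ℓ/ℚ)) (hσ : IsArithFrobAt ℤ σ 𝔓) :
    ℓ ∣ E.numPointsMod p ↔
      Module.End.HasEigenvalue
        (E.torsionRep ℓ σ : Module.End (ZMod ℓ) (E.torsionPoints ℓ WeierstrassCurve.QBar)) 1 := by
  let R := WeierstrassCurve.ratLocal p
  let W := (E.minimal R).integralModel R
  have : (E.reductionAt p).IsElliptic :=
    (WeierstrassCurve.hasGoodReduction_iff_isElliptic_reduction R).1 hgood
  have : W.IsElliptic := ⟨by
    have h := (E.reductionAt p).isUnit_Δ
    rw [WeierstrassCurve.reductionAt, WeierstrassCurve.reduction, WeierstrassCurve.map_Δ] at h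
    exact (isUnit_map_iff (IsLocalRing.residue R) _).1 h⟩
  obtain ⟨C, hC⟩ : ∃ C : WeierstrassCurve.VariableChange ℚ, W.map R.subtype = C • E :=
    ⟨_, WeierstrassCurve.baseChange_integralModel_eq R (E.minimal R)⟩
  have hCM : ∀ (M : Type) [Field M] [Algebra ℚ M], W.map ((algebraMap ℚ M).comp R.subtype) =
      C.map (algebraMap ℚ M) • E.baseChange M := fun M _ _ => by
    rw [← WeierstrassCurve.map_map, hC, ← WeierstrassCurve.map_variableChange]
    rfl
  -- the `ℚ`-algebra structure found on `QBar` is that of a division ring of characteristic zero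
  have : Algebra.IsAlgebraic ℚ WeierstrassCurve.QBar := by
    convert! AlgebraicClosure.isAlgebraic ℚ
  have : Algebra.IsAlgebraic ℚ (E.torsionField ℓ) := IntermediateField.isAlgebraic_tower_bot
  rw [WeierstrassCurve.hasEigenvalue_torsionRep_iff]
  refine (WeierstrassCurve.dvd_card_point_iff_exists_fixed hpℓ (W := W) (E.torsionField ℓ).val ?_
    𝔓 σ hσ).trans ?_
  · intro x y h h0
    have h' := h
    rw [hCM WeierstrassCurve.QBar, WeierstrassCurve.nonsingular_variableChange_iff] at h'
    have hmem := AddSubgroup.torsionBy.nsmul_iff.2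
      ((WeierstrassCurve.nsmul_some_eq_zero_iff_of_variableChange (hCM WeierstrassCurve.QBar) ℓ h h').1 h0)
    exact E.mem_torsionField_of_variableChange C
      (IntermediateField.subset_adjoin ℚ _ ⟨_, _, h', hmem, Or.inl rfl⟩)
      (IntermediateField.subset_adjoin ℚ _ ⟨_, _, h', hmem, Or.inr rfl⟩)
  · exact WeierstrassCurve.exists_fixed_nsmul_eq_zero_iff_of_variableChange σ (hCM _)
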